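/- Let $d\in\mathbb N$ and let $\Omega\subset\mathbb R^d$ be a bounded open set, for instance a bounded domain with Lipschitz boundary. $\langle\cdot,\cdot\rangle$ denotes the inner product of $L^2(\Omega)$ or $L^2(\Omega)^d$; $H(\mathrm{div};\Omega)$ is the space of $v\in L^2(\Omega)^d$ with weak divergence $\nabla\cdot v\in L^2(\Omega)$; $H^1_0(\Omega)$ is the closure of $C_c^\infty(\Omega)$ in $H^1(\Omega)$ (for a Lipschitz domain: the $H^1$ functions with vanishing trace). Let $s:\mathbb R\to[0,1]$ be monotone increasing and Lipschitz continuous. Let $a:\mathbb R\to\mathbb R$ be Lipschitz continuous with $0<a_\star\le a(y)\le a^\star<\infty$ for all $y\in\mathbb R$. Let $f_w,f_2:\mathbb R\to\mathbb R$ and $\mathbf f_1,\mathbf f_3:\mathbb R\to\mathbb R^d$ be Lipschitz continuous, with $f_w$ bounded. Let $\tau>0$ be the time step and let $\Theta^{n-1}\in L^2(\Omega)$ be given. Problem $P^n$ (mixed): find $\Theta^n,p^n\in L^2(\Omega)$ and $\mathbf q^n,\mathbf u^n\in H(\mathrm{div};\Omega)$ such that, with $s^k=s(\Theta^k)$, $$\langle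 s^n-s^{n-1},w\rangle+\tau\langle\nabla\cdot\mathbf q^n,w\rangle=0,$$ $$\langle\mathbf q^n,\mathbf v\rangle-\langle\Theta^n,\nabla\cdot\mathbf v\rangle-\langle f_w(s^n)\mathbf u^n,\mathbf v\rangle=\langle\mathbf f_1(s^n),\mathbf v\rangle,$$ $$\langle\nabla\cdot\mathbf u^n,w\rangle=\langle f_2(s^n),w\rangle,$$ $$\langle a(s^n)\mathbf u^n,\mathbf v\rangle-\langle p^n,\nabla\cdot\mathbf v\rangle+\langle\mathbf f_3(s^n),\mathbf v\rangle=0$$ for all $w\in L^2(\Omega)$ and all $\mathbf v\in H(\mathrm{div};\Omega)$. Problem $PC^n$ (conformal): find $\Theta_C^n,p_C^n\in H^1_0(\Omega)$ such that, with $s_C^n=s(\Theta_C^n)$, $$\langle s_C^n-s(\Theta^{n-1}),v\rangle+\tau\Big\langle\nabla\Theta_C^n+\frac{f_w(s_C^n)}{a(s_C^n)}\nabla p_C^n,\nabla v\Big\rangle+\tau\Big\langle\frac{f_w(s_C^n)}{a(s_C^n)}\mathbf f_3(s_C^n)-\mathbf f_1(s_C^n),\nabla v\Big\rangle=0,$$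 $$\Big\langle\frac1{a(s_C^n)}\big(\nabla p_C^n+\mathbf f_3(s_C^n)\big),\nabla w\Big\rangle=\langle f_2(s_C^n),w\rangle$$ for all $v,w\in H^1_0(\Omega)$. Then: (i) If $(\Theta_C^n,p_C^n)$ solves $PC^n$, then a solution of $P^n$ is given by $\Theta^n=\Theta_C^n$, $p^n=p_C^n$, $$\mathbf q^n=-\nabla\Theta_C^n-\frac{f_w(s_C^n)}{a(s_C^n)}\big(\nabla p_C^n+\mathbf f_3(s_C^n)\big)+\mathbf f_1(s_C^n),\qquad \mathbf u^n=-\frac1{a(s_C^n)}\big(\nabla p_C^n+\mathbf f_3(s_C^n)\big).$$ (ii) Conversely, if $(\Theta^n,p^n,\mathbf q^n,\mathbf u^n)$ solves $P^n$, then $\Theta^n,p^n\in H^1_0(\Omega)$ and $(\Theta^n,p^n)$ solves $PC^n$. (iii) Consequently, existence and uniqueness carry over: $P^n$ has a solution if and only if $PC^n$ has one, and $P^n$ has at most one solution if and only if $PC^n$ has at most one. -/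

import Mathlib

open MeasureTheory Set
open scoped ContDiff ENNReal

noncomputable section

namespace TwoPhase

/-- The Euclidean space `ℝ^d`. -/
abbrev E (d : ℕ) := EuclideanSpace ℝ (Fin d)

/-- Scalar `L²(Ω)`. -/
abbrev L2 {d : ℕ} (Ω : Set (E d)) := Lp ℝ 2 ((volume : Measure (E d)).restrict Ω)

/-- Vector-valued `L²(Ω)^d`. -/
abbrev L2V {d : ℕ} (Ω : Set (E d)) := Lp (E d) 2 ((volume : Measure (E d)).restrict Ω)

/-- `φ ∈ C_c^∞(Ω)`. -/
structure IsTest {d : ℕ} (Ω : Set (E d)) (φ : E d → ℝ) : Prop where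
  smooth : ContDiff ℝ ∞ φ
  compact : HasCompactSupport φ
  supp : tsupport φ ⊆ Ω

/-- `g` is the weak gradient of `u` on `Ω`. -/
def HasWeakGrad {d : ℕ} {Ω : Set (E d)} (u : L2 Ω) (g : L2V Ω) : Prop :=
  ∀ φ : E d → ℝ, IsTest Ω φ → ∀ i : Fin d,
    ∫ x in Ω, u x * fderiv ℝ φ x (EuclideanSpace.single i 1) = -∫ x in Ω, g x i * φ x

/-- `h` is the weak divergence of `v` on `Ω`. -/
def HasWeakDiv {d : ℕ} {Ω : Set (E d)} (v : L2V Ω) (h : L2 Ω) : Prop :=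
  ∀ φ : E d → ℝ, IsTest Ω φ →
    ∫ x in Ω, inner ℝ (v x) (gradient φ x) = -∫ x in Ω, h x * φ x

/-- `u ∈ H¹(Ω)`. -/
def MemH1 {d : ℕ} {Ω : Set (E d)} (u : L2 Ω) : Prop := ∃ g : L2V Ω, HasWeakGrad u g

/-- `v ∈ H(div; Ω)`. -/
def MemHdiv {d : ℕ} {Ω : Set (E d)} (v : L2V Ω) : Prop := ∃ h : L2 Ω, HasWeakDiv v h

open Classical in
/-- The weak gradient `∇u` of `u ∈ H¹(Ω)` (and `0` for other `u`). -/
def weakGrad {d : ℕ} {Ω : Set (E d)} (u : L2 Ω) : L2V Ω :=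
  if h : MemH1 u then h.choose else 0

open Classical in
/-- The weak divergence `∇ · v` of `v ∈ H(div; Ω)` (and `0` for other `v`). -/
def weakDiv {d : ℕ} {Ω : Set (E d)} (v : L2V Ω) : L2 Ω :=
  if h : MemHdiv v then h.choose else 0

/-- `u ∈ H¹₀(Ω)`, the closure of `C_c^∞(Ω)` in `H¹(Ω)`. -/
def MemH10 {d : ℕ} {Ω : Set (E d)} (u : L2 Ω) : Prop :=
  MemH1 u ∧ ∀ ε : ℝ≥0∞, 0 < ε → ∃ φ : E d → ℝ, IsTest Ω φ ∧
    eLpNorm (fun x => φ x - u x) 2 (volume.restrict Ω) < ε ∧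
    eLpNorm (fun x => gradient φ x - weakGrad u x) 2 (volume.restrict Ω) < ε

/-- Square integrable functions on `Ω` that agree on all test functions are equal a.e. -/
theorem ae_eq_of_test {d : ℕ} {Ω : Set (E d)} (hΩ : IsOpen Ω) {f g : E d → ℝ}
    (hf : MemLp f 2 ((volume : Measure (E d)).restrict Ω))
    (hg : MemLp g 2 ((volume : Measure (E d)).restrict Ω))
    (h : ∀ φ : E d → ℝ, IsTest Ω φ → ∫ x in Ω, f x * φ x = ∫ x in Ω, g x * φ x) :
    f =ᵐ[(volume : Measure (E d)).restrict Ω] g := by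
  have hfg : LocallyIntegrableOn (fun x => f x - g x) Ω volume := by
    rw [locallyIntegrableOn_iff hΩ.isLocallyClosed]
    intro K hK hKc
    have h1 : MemLp (fun x => f x - g x) 2 ((volume : Measure (E d)).restrict K) :=
      (hf.sub hg).mono_measure (Measure.restrict_mono hK le_rfl)
    have : IsFiniteMeasure ((volume : Measure (E d)).restrict K) :=
      ⟨by simpa using hKc.measure_lt_top⟩
    exact h1.integrable (by norm_num)
  have key := hΩ.ae_eq_zero_of_integral_contDiff_smul_eq_zero hfg (fun φ h1 h2 h3 => by
    have hφ : MemLp φ 2 ((volume : Measure (E d)).restrict Ω) :=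
      (h1.continuous.memLp_of_hasCompactSupport h2).mono_measure Measure.restrict_le_self
    have e1 : ∫ x, φ x • (f x - g x) = ∫ x in Ω, φ x • (f x - g x) := by
      refine (setIntegral_eq_integral_of_forall_compl_eq_zero fun x hx => ?_).symm
      rw [image_eq_zero_of_notMem_tsupport (fun hx' => hx (h3 hx')), zero_smul]
    rw [e1, ← sub_eq_zero.mpr (h φ ⟨h1, h2, h3⟩)]
    refine Eq.trans ?_ (integral_sub (hf.integrable_mul hφ) (hg.integrable_mul hφ))
    refine integral_congr_ae (Filter.Eventually.of_forall fun x => ?_)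
    simp only [smul_eq_mul, Pi.mul_apply]
    ring)
  refine (ae_restrict_iff' hΩ.measurableSet).mpr ?_
  filter_upwards [key] with x hx hxΩ
  exact sub_eq_zero.mp (hx hxΩ)

/-- Weak divergences are unique, so `weakDiv` does not depend on the choice made in it. -/
theorem HasWeakDiv.weakDiv_eq {d : ℕ} {Ω : Set (E d)} (hΩ : IsOpen Ω) {v : L2V Ω} {h : L2 Ω}
    (hv : HasWeakDiv v h) : weakDiv v = h := by
  have hex : MemHdiv v := ⟨h, hv⟩
  rw [weakDiv, dif_pos hex]
  refine Lp.ext (ae_eq_of_test hΩ (Lp.memLp _) (Lp.memLp _) fun φ hφ => ?_)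
  exact neg_injective ((hex.choose_spec φ hφ).symm.trans (hv φ hφ))

/-- Weak gradients are unique, so `weakGrad` does not depend on the choice made in it. -/
theorem HasWeakGrad.weakGrad_eq {d : ℕ} {Ω : Set (E d)} (hΩ : IsOpen Ω) {u : L2 Ω} {g : L2V Ω}
    (hu : HasWeakGrad u g) : weakGrad u = g := by
  have hex : MemH1 u := ⟨g, hu⟩
  rw [weakGrad, dif_pos hex]
  have hc : ∀ (k : L2V Ω) (i : Fin d),
      MemLp (fun x => k x i) 2 ((volume : Measure (E d)).restrict Ω) := fun k i =>
    (EuclideanSpace.proj (𝕜 := ℝ) i).comp_memLp' (Lp.memLp k)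
  have hi : ∀ i : Fin d, ∀ᵐ x ∂((volume : Measure (E d)).restrict Ω),
      hex.choose x i = g x i := fun i =>
    ae_eq_of_test hΩ (hc _ i) (hc _ i) fun φ hφ =>
      neg_injective ((hex.choose_spec φ hφ i).symm.trans (hu φ hφ i))
  refine Lp.ext ?_
  filter_upwards [ae_all_iff.mpr hi] with x hx
  ext i
  exact hx i

/-- The coefficient functions of the model. -/
structure Coeffs (d : ℕ) where
  s : ℝ → ℝ
  a : ℝ → ℝ
  fw : ℝ → ℝ
  f₁ : ℝ → E d
  f₂ : ℝ → ℝ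
  f₃ : ℝ → E d

/-- The assumptions on the coefficient functions. -/
structure Coeffs.Admissible {d : ℕ} (c : Coeffs d) : Prop where
  s_mem : ∀ y, c.s y ∈ Icc (0 : ℝ) 1
  s_mono : Monotone c.s
  s_lip : ∃ K, LipschitzWith K c.s
  a_lip : ∃ K, LipschitzWith K c.a
  a_bounds : ∃ m M : ℝ, 0 < m ∧ ∀ y, m ≤ c.a y ∧ c.a y ≤ M
  f₁_lip : ∃ K, LipschitzWith K c.f₁
  f₂_lip : ∃ K, LipschitzWith K c.f₂
  f₃_lip : ∃ K, LipschitzWith K c.f₃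
  fw_lip : ∃ K, LipschitzWith K c.fw
  fw_bdd : ∃ M : ℝ, ∀ y, |c.fw y| ≤ M

/-- `(Θ, p, q, u)` solves the semi-discrete mixed problem `Pⁿ` with time step `τ` and
previous iterate `Θ' = Θⁿ⁻¹`. -/
structure SolvesMixed {d : ℕ} {Ω : Set (E d)} (c : Coeffs d) (τ : ℝ) (Θ' : L2 Ω)
    (Θ p : L2 Ω) (q u : L2V Ω) : Prop where
  q_mem : MemHdiv q
  u_mem : MemHdiv u
  balance : ∀ w : L2 Ω,
    (∫ x in Ω, (c.s (Θ x) - c.s (Θ' x)) * w x) + τ * ∫ x in Ω, weakDiv q x * w x = 0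
  flux : ∀ v : L2V Ω, MemHdiv v →
    (∫ x in Ω, inner ℝ (q x) (v x)) - (∫ x in Ω, Θ x * weakDiv v x)
      - (∫ x in Ω, inner ℝ (c.fw (c.s (Θ x)) • u x) (v x))
      = ∫ x in Ω, inner ℝ (c.f₁ (c.s (Θ x))) (v x)
  total_balance : ∀ w : L2 Ω,
    ∫ x in Ω, weakDiv u x * w x = ∫ x in Ω, c.f₂ (c.s (Θ x)) * w x
  total_flux : ∀ v : L2V Ω, MemHdiv v →
    (∫ x in Ω, inner ℝ (c.a (c.s (Θ x)) • u x) (v x)) - (∫ x in Ω, p x * weakDiv v x)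
      + (∫ x in Ω, inner ℝ (c.f₃ (c.s (Θ x))) (v x)) = 0

/-- `(Θ, p)` solves the semi-discrete conformal problem `PCⁿ` with time step `τ` and
previous iterate `Θ' = Θⁿ⁻¹`. -/
structure SolvesConformal {d : ℕ} {Ω : Set (E d)} (c : Coeffs d) (τ : ℝ) (Θ' : L2 Ω)
    (Θ p : L2 Ω) : Prop where
  Θ_mem : MemH10 Θ
  p_mem : MemH10 p
  saturation : ∀ v : L2 Ω, MemH10 v →
    (∫ x in Ω, (c.s (Θ x) - c.s (Θ' x)) * v x)
      + τ * ((∫ x in Ω, inner ℝ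
            (weakGrad Θ x + (c.fw (c.s (Θ x)) / c.a (c.s (Θ x))) • weakGrad p x) (weakGrad v x))
          + ∫ x in Ω, inner ℝ
            ((c.fw (c.s (Θ x)) / c.a (c.s (Θ x))) • c.f₃ (c.s (Θ x)) - c.f₁ (c.s (Θ x)))
            (weakGrad v x)) = 0
  pressure : ∀ w : L2 Ω, MemH10 w →
    ∫ x in Ω, inner ℝ ((1 / c.a (c.s (Θ x))) • (weakGrad p x + c.f₃ (c.s (Θ x)))) (weakGrad w x)
      = ∫ x in Ω, c.f₂ (c.s (Θ x)) * w x

end TwoPhase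

end

open TwoPhase

/-! In `L²(Ω) × L²(Ω)^d` the pairs `(∇ · v, v)` with `v ∈ H(div; Ω)` are by definition the
orthogonal complement of the graph of `∇` on test functions, and the closure of that graph is the
graph of `∇` on `H¹₀(Ω)`. By the double orthogonal complement, a Green identity tested against all
of `H(div; Ω)` says exactly that its scalar part lies in `H¹₀(Ω)` and has the vector part as weak
gradient. The two flux equations of the mixed problem are such identities, and solving for `q` and
`u` turns them into `Θ, p ∈ H¹₀(Ω)` together with the explicit flux formulas. Dually, a Green
identity tested against `H¹₀(Ω)` determines the weak divergence, so for these fluxes the two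
conservation equations are the two conformal equations. The mixed solutions thus form the graph of
the flux map over the conformal solutions. -/

noncomputable section

namespace TwoPhase

section Hilbert

variable {H₁ H₂ : Type*} [NormedAddCommGroup H₁] [InnerProductSpace ℝ H₁] [CompleteSpace H₁]
  [NormedAddCommGroup H₂] [InnerProductSpace ℝ H₂] [CompleteSpace H₂]

theorem mem_topologicalClosure_prod_iff_forall_inner_eq_zero {K : Submodule ℝ (H₁ × H₂)}
    {z : H₁ × H₂} :
    z ∈ K.topologicalClosure ↔
      ∀ w : H₁ × H₂, (∀ k ∈ K, inner ℝ w.1 k.1 + inner ℝ w.2 k.2 = 0) →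
        inner ℝ z.1 w.1 + inner ℝ z.2 w.2 = 0 := by
  -- The max norm is equivalent to a Hilbert norm, for which the claim is `Kᗮᗮ = closure K`.
  let e := WithLp.prodContinuousLinearEquiv 2 ℝ H₁ H₂
  let K' : Submodule ℝ (WithLp 2 (H₁ × H₂)) := K.comap e.toLinearMap
  have orthogonal_iff (w : WithLp 2 (H₁ × H₂)) :
      w ∈ K'ᗮ ↔ ∀ k ∈ K, inner ℝ w.fst k.1 + inner ℝ w.snd k.2 = 0 := by
    rw [Submodule.mem_orthogonal']
    exact (WithLp.equiv 2 (H₁ × H₂)).forall_congr fun k => by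
      simp [K', e, WithLp.prod_inner_apply]
  have closure_iff : z ∈ K.topologicalClosure ↔ e.symm z ∈ K'.topologicalClosure := by
    have h : e ⁻¹' closure K = closure (e ⁻¹' K) := e.toHomeomorph.preimage_closure K
    exact Set.ext_iff.1 h (e.symm z)
  rw [closure_iff, ← Submodule.orthogonal_orthogonal_eq_closure, Submodule.mem_orthogonal']
  exact (WithLp.equiv 2 (H₁ × H₂)).forall_congr fun w => by
    rw [orthogonal_iff, WithLp.prod_inner_apply]
    rfl

end Hilbert

section LpPairing

variable {α F : Type*} [MeasurableSpace α] {μ : Measure α} [NormedAddCommGroup F] {p q : ℝ≥0∞}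

theorem eq_toLp_iff_ae_eq {u : Lp F p μ} {f : α → F} (hf : MemLp f p μ) :
    u = hf.toLp ↔ u =ᵐ[μ] f := by
  rw [Lp.ext_iff]
  exact ⟨fun h => h.trans hf.coeFn_toLp, fun h => h.trans hf.coeFn_toLp.symm⟩

theorem edist_toLp_right [Fact (1 ≤ p)] (u : Lp F p μ) {f : α → F} (hf : MemLp f p μ) :
    edist u hf.toLp = eLpNorm (fun x => f x - u x) p μ := by
  rw [edist_comm, Lp.edist_def]
  exact eLpNorm_congr_ae (hf.coeFn_toLp.sub .rfl)

theorem memLp_top_comp {X : Type*} [PseudoMetricSpace X] [ProperSpace X] {s : α → X} {f : X → F}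
    (hs : AEStronglyMeasurable s μ) (hbdd : Bornology.IsBounded (range s)) (hf : Continuous f) :
    MemLp (fun x => f (s x)) ∞ μ := by
  obtain ⟨C, hC⟩ := hbdd.isCompact_closure.exists_bound_of_continuousOn hf.continuousOn
  exact memLp_top_of_bound (hf.comp_aestronglyMeasurable hs) C
    (.of_forall fun x => hC _ (subset_closure (mem_range_self x)))

variable [InnerProductSpace ℝ F]

theorem integrable_inner_of_memLp [ENNReal.HolderConjugate p q] {f g : α → F}
    (hf : MemLp f p μ) (hg : MemLp g q μ) : Integrable (fun x => inner ℝ (f x) (g x)) μ :=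
  memLp_one_iff_integrable.1 ((innerSL ℝ).memLp_of_bilin 1 hf hg)

theorem integral_inner_add_left [ENNReal.HolderConjugate p q] {f g v : α → F}
    (hf : MemLp f p μ) (hg : MemLp g p μ) (hv : MemLp v q μ) :
    ∫ x, inner ℝ (f x + g x) (v x) ∂μ
      = (∫ x, inner ℝ (f x) (v x) ∂μ) + ∫ x, inner ℝ (g x) (v x) ∂μ := by
  simp only [inner_add_left]
  exact integral_add (integrable_inner_of_memLp hf hv) (integrable_inner_of_memLp hg hv)

theorem integral_inner_sub_left [ENNReal.HolderConjugate p q] {f g v : α → F}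
    (hf : MemLp f p μ) (hg : MemLp g p μ) (hv : MemLp v q μ) :
    ∫ x, inner ℝ (f x - g x) (v x) ∂μ
      = (∫ x, inner ℝ (f x) (v x) ∂μ) - ∫ x, inner ℝ (g x) (v x) ∂μ := by
  simp only [inner_sub_left]
  exact integral_sub (integrable_inner_of_memLp hf hv) (integrable_inner_of_memLp hg hv)

theorem integral_inner_neg_left (f v : α → F) :
    ∫ x, inner ℝ (-f x) (v x) ∂μ = -∫ x, inner ℝ (f x) (v x) ∂μ := by
  simp only [inner_neg_left, integral_neg]

theorem inner_toLp_left {f : α → F} (hf : MemLp f 2 μ) (u : Lp F 2 μ) :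
    inner ℝ hf.toLp u = ∫ x, inner ℝ (f x) (u x) ∂μ := by
  rw [L2.inner_def]
  exact integral_congr_ae (hf.coeFn_toLp.mono fun x hx => by simp only [hx])

theorem inner_toLp_right (u : Lp F 2 μ) {f : α → F} (hf : MemLp f 2 μ) :
    inner ℝ u hf.toLp = ∫ x, inner ℝ (u x) (f x) ∂μ := by
  rw [real_inner_comm, inner_toLp_left]
  simp only [real_inner_comm]

theorem continuous_integral_inner {f : α → F} (hf : MemLp f 2 μ) :
    Continuous fun u : Lp F 2 μ => ∫ x, inner ℝ (u x) (f x) ∂μ := by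
  simp only [← inner_toLp_right _ hf]
  fun_prop

theorem ae_eq_iff_forall_integral_inner_eq {f g : α → F} (hf : MemLp f 2 μ) (hg : MemLp g 2 μ) :
    f =ᵐ[μ] g ↔
      ∀ w : Lp F 2 μ, ∫ x, inner ℝ (f x) (w x) ∂μ = ∫ x, inner ℝ (g x) (w x) ∂μ := by
  simp only [← inner_toLp_left hf, ← inner_toLp_left hg, ← MemLp.toLp_eq_toLp_iff hf hg]
  exact ⟨fun h w => by rw [h], ext_inner_right ℝ⟩

end LpPairing

section Gradient

variable {H : Type*} [NormedAddCommGroup H] [InnerProductSpace ℝ H] [CompleteSpace H]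
  {φ ψ : H → ℝ} {x : H}

theorem gradient_add (hφ : DifferentiableAt ℝ φ x) (hψ : DifferentiableAt ℝ ψ x) :
    gradient (φ + ψ) x = gradient φ x + gradient ψ x := by
  simp only [gradient, fderiv_add hφ hψ, map_add]

theorem gradient_const_smul (r : ℝ) (hφ : DifferentiableAt ℝ φ x) :
    gradient (r • φ) x = r • gradient φ x := by
  simp only [gradient, fderiv_const_smul hφ, map_smulₛₗ, conj_trivial]

theorem gradient_apply_eq_fderiv_single {ι : Type*} [Fintype ι] [DecidableEq ι]
    (φ : EuclideanSpace ℝ ι → ℝ) (x : EuclideanSpace ℝ ι) (i : ι) :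
    gradient φ x i = fderiv ℝ φ x (EuclideanSpace.single i 1) := by
  simp [← inner_gradient_left, EuclideanSpace.inner_single_right]

end Gradient

variable {d : ℕ} {Ω : Set (E d)}

section IsTest

variable {φ ψ : E d → ℝ}

theorem IsTest.differentiable (hφ : IsTest Ω φ) : Differentiable ℝ φ :=
  hφ.smooth.differentiable (by simp)

theorem IsTest.continuous_gradient (hφ : IsTest Ω φ) : Continuous (gradient φ) :=
  (InnerProductSpace.toDual ℝ (E d)).symm.continuous.comp
    (hφ.smooth.continuous_fderiv (by simp))

theorem IsTest.hasCompactSupport_gradient (hφ : IsTest Ω φ) : HasCompactSupport (gradient φ) :=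
  (hφ.compact.fderiv (𝕜 := ℝ)).comp_left (map_zero (InnerProductSpace.toDual ℝ (E d)).symm)

theorem IsTest.memLp (hφ : IsTest Ω φ) (p : ℝ≥0∞) : MemLp φ p (volume.restrict Ω) :=
  (hφ.smooth.continuous.memLp_of_hasCompactSupport hφ.compact).restrict Ω

theorem IsTest.memLp_gradient (hφ : IsTest Ω φ) (p : ℝ≥0∞) :
    MemLp (gradient φ) p (volume.restrict Ω) :=
  (hφ.continuous_gradient.memLp_of_hasCompactSupport hφ.hasCompactSupport_gradient).restrict Ω

theorem IsTest.zero : IsTest Ω (0 : E d → ℝ) where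
  smooth := contDiff_const
  compact := HasCompactSupport.zero
  supp := by simp [tsupport]

theorem IsTest.add (hφ : IsTest Ω φ) (hψ : IsTest Ω ψ) : IsTest Ω (φ + ψ) where
  smooth := hφ.smooth.add hψ.smooth
  compact := hφ.compact.add hψ.compact
  supp := (tsupport_add φ ψ).trans (union_subset hφ.supp hψ.supp)

theorem IsTest.const_smul (r : ℝ) (hφ : IsTest Ω φ) : IsTest Ω (r • φ) where
  smooth := hφ.smooth.const_smul r
  compact := hφ.compact.smul_left (f := fun _ => r)
  supp := (closure_mono (Function.support_const_smul_subset r φ)).trans hφ.supp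

theorem integral_mul_gradient_eq_neg (hφ : IsTest Ω φ) (hψ : IsTest Ω ψ) (i : Fin d) :
    ∫ x in Ω, φ x * gradient ψ x i = -∫ x in Ω, gradient φ x i * ψ x := by
  have hc {χ : E d → ℝ} (hχ : IsTest Ω χ) :
      Continuous fun x => fderiv ℝ χ x (EuclideanSpace.single i 1) :=
    (hχ.smooth.continuous_fderiv (by simp)).clm_apply continuous_const
  rw [setIntegral_eq_integral_of_forall_compl_eq_zero fun x hx => by
      rw [image_eq_zero_of_notMem_tsupport (fun hx' => hx (hφ.supp hx')), zero_mul],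
    setIntegral_eq_integral_of_forall_compl_eq_zero fun x hx => by
      rw [image_eq_zero_of_notMem_tsupport (fun hx' => hx (hψ.supp hx')), mul_zero]]
  simp only [gradient_apply_eq_fderiv_single]
  refine integral_mul_fderiv_eq_neg_fderiv_mul_of_integrable ?_ ?_ ?_
    (fun x _ => hφ.differentiable x) (fun x _ => hψ.differentiable x)
  · exact ((hc hφ).mul hψ.smooth.continuous).integrable_of_hasCompactSupport hψ.compact.mul_left
  · exact (hφ.smooth.continuous.mul (hc hψ)).integrable_of_hasCompactSupport hφ.compact.mul_right
  · exact (hφ.smooth.continuous.mul hψ.smooth.continuous).integrable_of_hasCompactSupport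
      hφ.compact.mul_right

variable (Ω) in
/-- The space `C_c^∞(Ω)` of test functions. -/
def testFunctions : Submodule ℝ (E d → ℝ) where
  carrier := {φ | IsTest Ω φ}
  zero_mem' := IsTest.zero
  add_mem' := IsTest.add
  smul_mem' r _ := IsTest.const_smul r

variable (Ω) in
/-- The map `φ ↦ (φ, ∇φ)` from `C_c^∞(Ω)` to `L²(Ω) × L²(Ω)^d`. -/
def testEmbedding : testFunctions Ω →ₗ[ℝ] L2 Ω × L2V Ω where
  toFun φ := ((φ.2.memLp 2).toLp, (φ.2.memLp_gradient 2).toLp)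
  map_add' φ ψ := Prod.ext rfl <|
    MemLp.toLp_congr ((φ + ψ).2.memLp_gradient 2)
      ((φ.2.memLp_gradient 2).add (ψ.2.memLp_gradient 2))
      (.of_forall fun x => gradient_add (φ.2.differentiable x) (ψ.2.differentiable x))
  map_smul' r φ := Prod.ext rfl <|
    MemLp.toLp_congr ((r • φ).2.memLp_gradient 2) ((φ.2.memLp_gradient 2).const_smul r)
      (.of_forall fun x => gradient_const_smul r (φ.2.differentiable x))

variable (Ω) in
/-- The graph `{(φ, ∇φ) : φ ∈ C_c^∞(Ω)}` of the gradient on test functions, whose closure is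
the graph of the weak gradient on `H¹₀(Ω)`. -/
def testGraph : Submodule ℝ (L2 Ω × L2V Ω) := (testEmbedding Ω).range

theorem forall_mem_testGraph {P : L2 Ω × L2V Ω → Prop} :
    (∀ z ∈ testGraph Ω, P z) ↔
      ∀ (φ : E d → ℝ) (hφ : IsTest Ω φ), P ((hφ.memLp 2).toLp, (hφ.memLp_gradient 2).toLp) :=
  ⟨fun H φ hφ => H _ ⟨⟨φ, hφ⟩, rfl⟩, by rintro H _ ⟨⟨φ, hφ⟩, rfl⟩; exact H φ hφ⟩

theorem exists_mem_testGraph {P : L2 Ω × L2V Ω → Prop} :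
    (∃ z ∈ testGraph Ω, P z) ↔
      ∃ (φ : E d → ℝ) (hφ : IsTest Ω φ), P ((hφ.memLp 2).toLp, (hφ.memLp_gradient 2).toLp) :=
  ⟨by rintro ⟨_, ⟨⟨φ, hφ⟩, rfl⟩, hP⟩; exact ⟨φ, hφ, hP⟩,
    fun ⟨φ, hφ, hP⟩ => ⟨_, ⟨⟨φ, hφ⟩, rfl⟩, hP⟩⟩

end IsTest

section Green

theorem hasWeakDiv_iff_forall_testGraph {v : L2V Ω} {h : L2 Ω} :
    HasWeakDiv v h ↔ ∀ z ∈ testGraph Ω, inner ℝ h z.1 + inner ℝ v z.2 = 0 := by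
  rw [forall_mem_testGraph]
  simp only [inner_toLp_right, Real.inner_apply]
  exact forall₂_congr fun φ _ => by rw [eq_neg_iff_add_eq_zero, add_comm]

theorem IsTest.hasWeakGrad {φ : E d → ℝ} (hφ : IsTest Ω φ) :
    HasWeakGrad (hφ.memLp 2).toLp (hφ.memLp_gradient 2).toLp := by
  intro ψ hψ i
  calc
    ∫ x in Ω, (hφ.memLp 2).toLp φ x * fderiv ℝ ψ x (EuclideanSpace.single i 1)
      = ∫ x in Ω, φ x * gradient ψ x i :=
        integral_congr_ae <| (hφ.memLp 2).coeFn_toLp.mono fun x hx => by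
          simp only [hx, gradient_apply_eq_fderiv_single]
    _ = -∫ x in Ω, gradient φ x i * ψ x := integral_mul_gradient_eq_neg hφ hψ i
    _ = -∫ x in Ω, (hφ.memLp_gradient 2).toLp (gradient φ) x i * ψ x :=
        congrArg Neg.neg <| integral_congr_ae <|
          (hφ.memLp_gradient 2).coeFn_toLp.mono fun x hx => by simp only [hx]

theorem isClosed_setOf_hasWeakGrad : IsClosed {z : L2 Ω × L2V Ω | HasWeakGrad z.1 z.2} := by
  simp only [HasWeakGrad, ofPred_forall]
  refine isClosed_iInter fun φ => isClosed_iInter fun hφ => isClosed_iInter fun i =>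
    isClosed_eq ?_ ?_
  · have hderiv : MemLp (fun x => fderiv ℝ φ x (EuclideanSpace.single i 1)) 2
        (volume.restrict Ω) := by
      simp only [← gradient_apply_eq_fderiv_single]
      exact (EuclideanSpace.proj (𝕜 := ℝ) i).comp_memLp' (hφ.memLp_gradient 2)
    simpa only [Real.inner_apply, Function.comp_def] using
      (continuous_integral_inner hderiv).comp continuous_fst
  · have hfield : MemLp (fun x => φ x • (EuclideanSpace.single i 1 : E d)) 2
        (volume.restrict Ω) :=
      (ContinuousLinearMap.toSpanSingleton ℝ _).comp_memLp' (hφ.memLp 2)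
    have inner_field (g : L2V Ω) (x : E d) :
        inner ℝ (g x) (φ x • EuclideanSpace.single i 1) = g x i * φ x := by
      simp [real_inner_smul_right, EuclideanSpace.inner_single_right, mul_comm]
    simp only [← inner_field]
    exact ((continuous_integral_inner hfield).comp continuous_snd).neg

theorem hasWeakGrad_of_mem_topologicalClosure_testGraph {u : L2 Ω} {g : L2V Ω}
    (h : (u, g) ∈ (testGraph Ω).topologicalClosure) : HasWeakGrad u g :=
  closure_minimal (forall_mem_testGraph.2 fun _ hφ => hφ.hasWeakGrad) isClosed_setOf_hasWeakGrad h

theorem mem_topologicalClosure_testGraph_iff {u : L2 Ω} {g : L2V Ω} :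
    (u, g) ∈ (testGraph Ω).topologicalClosure ↔
      ∀ ε : ℝ≥0∞, 0 < ε → ∃ φ : E d → ℝ, IsTest Ω φ ∧
        eLpNorm (fun x => φ x - u x) 2 (volume.restrict Ω) < ε ∧
        eLpNorm (fun x => gradient φ x - g x) 2 (volume.restrict Ω) < ε := by
  refine EMetric.mem_closure_iff.trans (forall₂_congr fun ε _ => exists_mem_testGraph.trans ?_)
  simp only [Prod.edist_eq, max_lt_iff, edist_toLp_right, exists_prop]

theorem memH10_and_weakGrad_eq_iff (hΩ : IsOpen Ω) {u : L2 Ω} {g : L2V Ω} :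
    MemH10 u ∧ weakGrad u = g ↔ (u, g) ∈ (testGraph Ω).topologicalClosure := by
  constructor
  · rintro ⟨hu, rfl⟩
    exact mem_topologicalClosure_testGraph_iff.2 hu.2
  · intro h
    have hg := hasWeakGrad_of_mem_topologicalClosure_testGraph h
    obtain rfl := hg.weakGrad_eq hΩ
    exact ⟨⟨⟨_, hg⟩, mem_topologicalClosure_testGraph_iff.1 h⟩, rfl⟩

theorem memHdiv_and_weakDiv_eq_iff (hΩ : IsOpen Ω) {v : L2V Ω} {h : L2 Ω} :
    MemHdiv v ∧ weakDiv v = h ↔ HasWeakDiv v h := by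
  refine ⟨?_, fun hv => ⟨⟨h, hv⟩, hv.weakDiv_eq hΩ⟩⟩
  rintro ⟨hv, rfl⟩
  rw [weakDiv, dif_pos hv]
  exact hv.choose_spec

theorem memH10_and_weakGrad_eq_iff_forall_memHdiv (hΩ : IsOpen Ω) {u : L2 Ω} {g : L2V Ω} :
    MemH10 u ∧ weakGrad u = g ↔
      ∀ v : L2V Ω, MemHdiv v → inner ℝ u (weakDiv v) + inner ℝ g v = 0 := by
  rw [memH10_and_weakGrad_eq_iff hΩ, mem_topologicalClosure_prod_iff_forall_inner_eq_zero]
  constructor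
  · intro H v hv
    have hdiv := (memHdiv_and_weakDiv_eq_iff hΩ).1 ⟨hv, rfl⟩
    exact H (weakDiv v, v) (hasWeakDiv_iff_forall_testGraph.1 hdiv)
  · rintro H ⟨h, v⟩ hw
    obtain ⟨hv, rfl⟩ : MemHdiv v ∧ weakDiv v = h :=
      (memHdiv_and_weakDiv_eq_iff hΩ).2 (hasWeakDiv_iff_forall_testGraph.2 hw)
    exact H v hv

theorem memHdiv_and_weakDiv_eq_iff_forall_memH10 (hΩ : IsOpen Ω) {v : L2V Ω} {h : L2 Ω} :
    MemHdiv v ∧ weakDiv v = h ↔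
      ∀ u : L2 Ω, MemH10 u → inner ℝ h u + inner ℝ v (weakGrad u) = 0 := by
  constructor
  · rintro ⟨hv, rfl⟩ u hu
    rw [real_inner_comm, real_inner_comm (weakGrad u)]
    exact (memH10_and_weakGrad_eq_iff_forall_memHdiv hΩ).1 ⟨hu, rfl⟩ v hv
  · intro H
    rw [memHdiv_and_weakDiv_eq_iff hΩ, hasWeakDiv_iff_forall_testGraph]
    rintro ⟨u, g⟩ hz
    obtain ⟨hu, rfl⟩ := (memH10_and_weakGrad_eq_iff hΩ).2 (subset_closure hz)
    exact H u hu

theorem memH10_and_weakGrad_ae_eq_iff (hΩ : IsOpen Ω) {u : L2 Ω} {G : E d → E d}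
    (hG : MemLp G 2 (volume.restrict Ω)) :
    MemH10 u ∧ weakGrad u =ᵐ[volume.restrict Ω] G ↔
      ∀ v : L2V Ω, MemHdiv v →
        (∫ x in Ω, u x * weakDiv v x) + ∫ x in Ω, inner ℝ (G x) (v x) = 0 := by
  rw [← eq_toLp_iff_ae_eq hG, memH10_and_weakGrad_eq_iff_forall_memHdiv hΩ]
  simp only [inner_toLp_left]
  simp only [L2.inner_def, Real.inner_apply]

theorem memHdiv_and_weakDiv_ae_eq_iff (hΩ : IsOpen Ω) {v : L2V Ω} {h : E d → ℝ}
    (hh : MemLp h 2 (volume.restrict Ω)) :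
    MemHdiv v ∧ weakDiv v =ᵐ[volume.restrict Ω] h ↔
      ∀ w : L2 Ω, MemH10 w →
        (∫ x in Ω, h x * w x) + ∫ x in Ω, inner ℝ (v x) (weakGrad w x) = 0 := by
  rw [← eq_toLp_iff_ae_eq hh, memHdiv_and_weakDiv_eq_iff_forall_memH10 hΩ]
  simp only [inner_toLp_left]
  simp only [L2.inner_def, Real.inner_apply]

end Green

section Equations

variable {Θ p : L2 Ω} {q u : L2V Ω} {τ : ℝ}

theorem forall_flux_equation_iff (hΩ : IsOpen Ω) {F W : E d → E d}
    (hF : MemLp F 2 (volume.restrict Ω)) (hW : MemLp W 2 (volume.restrict Ω)) :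
    (∀ v : L2V Ω, MemHdiv v →
      (∫ x in Ω, inner ℝ (q x) (v x)) - (∫ x in Ω, Θ x * weakDiv v x)
        - (∫ x in Ω, inner ℝ (W x) (v x)) = ∫ x in Ω, inner ℝ (F x) (v x)) ↔
      MemH10 Θ ∧ weakGrad Θ =ᵐ[volume.restrict Ω] fun x => F x + W x - q x := by
  have hFW : MemLp (fun x => F x + W x) 2 (volume.restrict Ω) := hF.add hW
  have hG : MemLp (fun x => F x + W x - q x) 2 (volume.restrict Ω) := hFW.sub (Lp.memLp q)
  rw [memH10_and_weakGrad_ae_eq_iff hΩ hG]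
  refine forall₂_congr fun v _ => ?_
  have hv := Lp.memLp v
  rw [integral_inner_sub_left hFW (Lp.memLp q) hv, integral_inner_add_left hF hW hv]
  constructor <;> intro h <;> linarith

theorem forall_total_flux_equation_iff (hΩ : IsOpen Ω) {A F : E d → E d}
    (hA : MemLp A 2 (volume.restrict Ω)) (hF : MemLp F 2 (volume.restrict Ω)) :
    (∀ v : L2V Ω, MemHdiv v →
      (∫ x in Ω, inner ℝ (A x) (v x)) - (∫ x in Ω, p x * weakDiv v x)
        + (∫ x in Ω, inner ℝ (F x) (v x)) = 0) ↔
      MemH10 p ∧ weakGrad p =ᵐ[volume.restrict Ω] fun x => -(A x + F x) := by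
  have hG : MemLp (fun x => -(A x + F x)) 2 (volume.restrict Ω) := (hA.add hF).neg
  rw [memH10_and_weakGrad_ae_eq_iff hΩ hG]
  refine forall₂_congr fun v _ => ?_
  rw [integral_inner_neg_left, integral_inner_add_left hA hF (Lp.memLp v)]
  constructor <;> intro h <;> linarith

theorem memHdiv_and_forall_balance_iff (hΩ : IsOpen Ω) (hτ : τ ≠ 0) {D : E d → ℝ}
    {G₁ G₂ : E d → E d} (hD : MemLp D 2 (volume.restrict Ω))
    (hG₁ : MemLp G₁ 2 (volume.restrict Ω)) (hG₂ : MemLp G₂ 2 (volume.restrict Ω))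
    (hq : q =ᵐ[volume.restrict Ω] fun x => -(G₁ x + G₂ x)) :
    (MemHdiv q ∧
      ∀ w : L2 Ω, (∫ x in Ω, D x * w x) + τ * ∫ x in Ω, weakDiv q x * w x = 0) ↔
      ∀ w : L2 Ω, MemH10 w → (∫ x in Ω, D x * w x)
        + τ * ((∫ x in Ω, inner ℝ (G₁ x) (weakGrad w x))
          + ∫ x in Ω, inner ℝ (G₂ x) (weakGrad w x)) = 0 := by
  have hdiv : MemLp (fun x => -τ⁻¹ * D x) 2 (volume.restrict Ω) := hD.const_mul _
  have integral_div (w : L2 Ω) : ∫ x in Ω, -τ⁻¹ * D x * w x = -τ⁻¹ * ∫ x in Ω, D x * w x := by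
    simp only [mul_assoc, integral_const_mul]
  have balance_iff : (∀ w : L2 Ω,
      (∫ x in Ω, D x * w x) + τ * ∫ x in Ω, weakDiv q x * w x = 0) ↔
      weakDiv q =ᵐ[volume.restrict Ω] fun x => -τ⁻¹ * D x := by
    rw [ae_eq_iff_forall_integral_inner_eq (Lp.memLp _) hdiv]
    simp only [Real.inner_apply, integral_div]
    exact forall_congr' fun w => by field_simp; constructor <;> intro h <;> linarith
  rw [balance_iff, memHdiv_and_weakDiv_ae_eq_iff hΩ hdiv]
  refine forall₂_congr fun w _ => ?_
  have integral_q : ∫ x in Ω, inner ℝ (q x) (weakGrad w x)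
      = -((∫ x in Ω, inner ℝ (G₁ x) (weakGrad w x))
          + ∫ x in Ω, inner ℝ (G₂ x) (weakGrad w x)) := by
    rw [← integral_inner_add_left hG₁ hG₂ (Lp.memLp _), ← integral_inner_neg_left]
    exact integral_congr_ae (hq.mono fun x hx => by simp only [hx])
  rw [integral_div, integral_q]
  field_simp
  constructor <;> intro h <;> linarith

theorem memHdiv_and_forall_total_balance_iff (hΩ : IsOpen Ω) {f : E d → ℝ} {G : E d → E d}
    (hf : MemLp f 2 (volume.restrict Ω)) (hu : u =ᵐ[volume.restrict Ω] fun x => -G x) :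
    (MemHdiv u ∧ ∀ w : L2 Ω, ∫ x in Ω, weakDiv u x * w x = ∫ x in Ω, f x * w x) ↔
      ∀ w : L2 Ω, MemH10 w → ∫ x in Ω, inner ℝ (G x) (weakGrad w x) = ∫ x in Ω, f x * w x := by
  have balance_iff := ae_eq_iff_forall_integral_inner_eq (Lp.memLp (weakDiv u)) hf
  simp only [Real.inner_apply] at balance_iff
  rw [← balance_iff, memHdiv_and_weakDiv_ae_eq_iff hΩ hf]
  refine forall₂_congr fun w _ => ?_
  have integral_u : ∫ x in Ω, inner ℝ (u x) (weakGrad w x)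
      = -∫ x in Ω, inner ℝ (G x) (weakGrad w x) := by
    rw [← integral_inner_neg_left]
    exact integral_congr_ae (hu.mono fun x hx => by simp only [hx])
  rw [integral_u]
  constructor <;> intro h <;> linarith

end Equations

/-- The regularity of the coefficient functions under which every term of the two problems is
square integrable on a domain of finite volume and the fluxes can be solved for. -/
structure Coeffs.IsRegular (c : Coeffs d) : Prop where
  measurable_s : Measurable c.s
  isBounded_range_s : Bornology.IsBounded (range c.s)
  continuous_a : Continuous c.a
  a_ne_zero : ∀ y, c.a y ≠ 0
  continuous_fw : Continuous c.fw
  continuous_f₁ : Continuous c.f₁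
  continuous_f₂ : Continuous c.f₂
  continuous_f₃ : Continuous c.f₃

theorem Coeffs.Admissible.isRegular {c : Coeffs d} (hc : c.Admissible) : c.IsRegular where
  measurable_s := hc.s_mono.measurable
  isBounded_range_s := (Metric.isBounded_Icc 0 1).subset (range_subset_iff.2 hc.s_mem)
  continuous_a := hc.a_lip.choose_spec.continuous
  a_ne_zero y := by
    obtain ⟨m, _, hm, ha⟩ := hc.a_bounds
    exact (hm.trans_le (ha y).1).ne'
  continuous_fw := hc.fw_lip.choose_spec.continuous
  continuous_f₁ := hc.f₁_lip.choose_spec.continuous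
  continuous_f₂ := hc.f₂_lip.choose_spec.continuous
  continuous_f₃ := hc.f₃_lip.choose_spec.continuous

/-- The flux `q = -∇Θ - (f_w / a) (∇p + f₃) + f₁` of a conformal solution `(Θ, p)`, with the
coefficients evaluated at the saturation `s(Θ)`. -/
def saturationFlux (c : Coeffs d) (Θ p : L2 Ω) (x : E d) : E d :=
  -weakGrad Θ x - (c.fw (c.s (Θ x)) / c.a (c.s (Θ x))) • (weakGrad p x + c.f₃ (c.s (Θ x)))
    + c.f₁ (c.s (Θ x))

/-- The flux `u = -(1 / a) (∇p + f₃)` of a conformal solution `(Θ, p)`, with the coefficients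
evaluated at the saturation `s(Θ)`. -/
def totalFlux (c : Coeffs d) (Θ p : L2 Ω) (x : E d) : E d :=
  -((1 / c.a (c.s (Θ x))) • (weakGrad p x + c.f₃ (c.s (Θ x))))

theorem eq_add_smul_sub_and_eq_neg_add_iff {k V : Type*} [Field k] [AddCommGroup V] [Module k V]
    {a b : k} (ha : a ≠ 0) {g g' q u f f' : V} :
    (g = f + b • u - q ∧ g' = -(a • u + f')) ↔
      q = -g - (b / a) • (g' + f') + f ∧ u = -((1 / a) • (g' + f')) := by
  have u_iff : g' = -(a • u + f') ↔ u = -((1 / a) • (g' + f')) := by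
    rw [← smul_neg, one_div, eq_inv_smul_iff₀ ha]
    constructor <;> intro h <;> rw [h] <;> abel
  rw [u_iff]
  refine and_congr_left fun hu => ?_
  have hbu : b • u = -((b / a) • (g' + f')) := by rw [hu, smul_neg, smul_smul, mul_one_div]
  rw [hbu]
  constructor <;> intro h <;> rw [h] <;> abel

namespace Coeffs.IsRegular

variable {c : Coeffs d} {Θ Θ' p : L2 Ω} {q u : L2V Ω} {τ : ℝ}

theorem memLp_top_comp {F : Type*} [NormedAddCommGroup F] (hc : c.IsRegular) (Θ : L2 Ω)
    {f : ℝ → F} (hf : Continuous f) :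
    MemLp (fun x => f (c.s (Θ x))) ∞ (volume.restrict Ω) :=
  TwoPhase.memLp_top_comp (s := fun x => c.s (Θ x))
    (hc.measurable_s.comp_aemeasurable
      (Lp.aestronglyMeasurable Θ).aemeasurable).aestronglyMeasurable
    (hc.isBounded_range_s.subset (range_comp_subset_range Θ c.s)) hf

theorem memLp_comp {F : Type*} [NormedAddCommGroup F] [IsFiniteMeasure (volume.restrict Ω)]
    (hc : c.IsRegular) (Θ : L2 Ω) {f : ℝ → F} (hf : Continuous f) :
    MemLp (fun x => f (c.s (Θ x))) 2 (volume.restrict Ω) :=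
  (hc.memLp_top_comp Θ hf).mono_exponent le_top

theorem memLp_comp_smul (hc : c.IsRegular) (Θ : L2 Ω) {b : ℝ → ℝ} (hb : Continuous b)
    {v : E d → E d} (hv : MemLp v 2 (volume.restrict Ω)) :
    MemLp (fun x => b (c.s (Θ x)) • v x) 2 (volume.restrict Ω) :=
  hv.smul (hc.memLp_top_comp Θ hb)

theorem continuous_fw_div_a (hc : c.IsRegular) : Continuous fun y => c.fw y / c.a y :=
  hc.continuous_fw.div hc.continuous_a hc.a_ne_zero

variable [IsFiniteMeasure (volume.restrict Ω)]

theorem memLp_weakGrad_add_f₃ (hc : c.IsRegular) (Θ p : L2 Ω) :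
    MemLp (fun x => weakGrad p x + c.f₃ (c.s (Θ x))) 2 (volume.restrict Ω) :=
  (Lp.memLp (weakGrad p)).add (hc.memLp_comp Θ hc.continuous_f₃)

theorem memLp_saturationFlux (hc : c.IsRegular) (Θ p : L2 Ω) :
    MemLp (saturationFlux c Θ p) 2 (volume.restrict Ω) :=
  ((Lp.memLp (weakGrad Θ)).neg.sub (hc.memLp_comp_smul Θ hc.continuous_fw_div_a
    (hc.memLp_weakGrad_add_f₃ Θ p))).add (hc.memLp_comp Θ hc.continuous_f₁)

theorem memLp_totalFlux (hc : c.IsRegular) (Θ p : L2 Ω) :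
    MemLp (totalFlux c Θ p) 2 (volume.restrict Ω) :=
  (hc.memLp_comp_smul Θ (continuous_const.div hc.continuous_a hc.a_ne_zero)
    (hc.memLp_weakGrad_add_f₃ Θ p)).neg

theorem flux_equations_iff (hΩ : IsOpen Ω) (hc : c.IsRegular) :
    ((∀ v : L2V Ω, MemHdiv v →
      (∫ x in Ω, inner ℝ (q x) (v x)) - (∫ x in Ω, Θ x * weakDiv v x)
        - (∫ x in Ω, inner ℝ (c.fw (c.s (Θ x)) • u x) (v x))
        = ∫ x in Ω, inner ℝ (c.f₁ (c.s (Θ x))) (v x)) ∧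
     (∀ v : L2V Ω, MemHdiv v →
      (∫ x in Ω, inner ℝ (c.a (c.s (Θ x)) • u x) (v x)) - (∫ x in Ω, p x * weakDiv v x)
        + (∫ x in Ω, inner ℝ (c.f₃ (c.s (Θ x))) (v x)) = 0)) ↔
      (MemH10 Θ ∧ MemH10 p) ∧ q =ᵐ[volume.restrict Ω] saturationFlux c Θ p ∧
        u =ᵐ[volume.restrict Ω] totalFlux c Θ p := by
  rw [forall_flux_equation_iff hΩ (hc.memLp_comp Θ hc.continuous_f₁)
      (hc.memLp_comp_smul Θ hc.continuous_fw (Lp.memLp u)),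
    forall_total_flux_equation_iff hΩ (hc.memLp_comp_smul Θ hc.continuous_a (Lp.memLp u))
      (hc.memLp_comp Θ hc.continuous_f₃), and_and_and_comm]
  refine and_congr_right fun _ => ?_
  simp only [Filter.EventuallyEq, ← Filter.eventually_and]
  exact Filter.eventually_congr (.of_forall fun x =>
    eq_add_smul_sub_and_eq_neg_add_iff (hc.a_ne_zero _))

theorem memHdiv_and_balance_iff_saturation (hΩ : IsOpen Ω) (hc : c.IsRegular) (hτ : τ ≠ 0)
    (hq : q =ᵐ[volume.restrict Ω] saturationFlux c Θ p) :
    (MemHdiv q ∧ ∀ w : L2 Ω,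
      (∫ x in Ω, (c.s (Θ x) - c.s (Θ' x)) * w x) + τ * ∫ x in Ω, weakDiv q x * w x = 0) ↔
    ∀ v : L2 Ω, MemH10 v →
      (∫ x in Ω, (c.s (Θ x) - c.s (Θ' x)) * v x)
        + τ * ((∫ x in Ω, inner ℝ
              (weakGrad Θ x + (c.fw (c.s (Θ x)) / c.a (c.s (Θ x))) • weakGrad p x) (weakGrad v x))
            + ∫ x in Ω, inner ℝ
              ((c.fw (c.s (Θ x)) / c.a (c.s (Θ x))) • c.f₃ (c.s (Θ x)) - c.f₁ (c.s (Θ x)))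
              (weakGrad v x)) = 0 := by
  have memLp_s (θ : L2 Ω) : MemLp (fun x => c.s (θ x)) 2 (volume.restrict Ω) :=
    hc.memLp_comp θ continuous_id
  have memLp_fw_div_a_smul {v : E d → E d} (hv : MemLp v 2 (volume.restrict Ω)) :
      MemLp (fun x => (c.fw (c.s (Θ x)) / c.a (c.s (Θ x))) • v x) 2 (volume.restrict Ω) :=
    hc.memLp_comp_smul Θ hc.continuous_fw_div_a hv
  refine memHdiv_and_forall_balance_iff hΩ hτ ((memLp_s Θ).sub (memLp_s Θ'))
    ((Lp.memLp (weakGrad Θ)).add (memLp_fw_div_a_smul (Lp.memLp (weakGrad p))))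
    ((memLp_fw_div_a_smul (hc.memLp_comp Θ hc.continuous_f₃)).sub
      (hc.memLp_comp Θ hc.continuous_f₁))
    (hq.trans (.of_forall fun x => ?_))
  simp only [saturationFlux, smul_add]
  abel

theorem memHdiv_and_total_balance_iff_pressure (hΩ : IsOpen Ω) (hc : c.IsRegular)
    (hu : u =ᵐ[volume.restrict Ω] totalFlux c Θ p) :
    (MemHdiv u ∧ ∀ w : L2 Ω,
      ∫ x in Ω, weakDiv u x * w x = ∫ x in Ω, c.f₂ (c.s (Θ x)) * w x) ↔
    ∀ w : L2 Ω, MemH10 w →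
      ∫ x in Ω, inner ℝ ((1 / c.a (c.s (Θ x))) • (weakGrad p x + c.f₃ (c.s (Θ x)))) (weakGrad w x)
        = ∫ x in Ω, c.f₂ (c.s (Θ x)) * w x :=
  memHdiv_and_forall_total_balance_iff hΩ (hc.memLp_comp Θ hc.continuous_f₂) hu

theorem solvesMixed_iff (hΩ : IsOpen Ω) (hc : c.IsRegular) (hτ : τ ≠ 0) :
    SolvesMixed c τ Θ' Θ p q u ↔
      SolvesConformal c τ Θ' Θ p ∧ q =ᵐ[volume.restrict Ω] saturationFlux c Θ p ∧
        u =ᵐ[volume.restrict Ω] totalFlux c Θ p := by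
  constructor
  · intro h
    obtain ⟨⟨hΘ, hp⟩, hq, hu⟩ := (hc.flux_equations_iff hΩ).1 ⟨h.flux, h.total_flux⟩
    exact ⟨⟨hΘ, hp, (hc.memHdiv_and_balance_iff_saturation hΩ hτ hq).1 ⟨h.q_mem, h.balance⟩,
      (hc.memHdiv_and_total_balance_iff_pressure hΩ hu).1 ⟨h.u_mem, h.total_balance⟩⟩, hq, hu⟩
  · rintro ⟨h, hq, hu⟩
    obtain ⟨hflux, htotal⟩ := (hc.flux_equations_iff hΩ).2 ⟨⟨h.Θ_mem, h.p_mem⟩, hq, hu⟩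
    obtain ⟨hqdiv, hbal⟩ := (hc.memHdiv_and_balance_iff_saturation hΩ hτ hq).2 h.saturation
    obtain ⟨hudiv, htbal⟩ := (hc.memHdiv_and_total_balance_iff_pressure hΩ hu).2 h.pressure
    exact ⟨hqdiv, hudiv, hbal, hflux, htbal, htotal⟩

theorem setOf_solvesMixed_eq_image (hΩ : IsOpen Ω) (hc : c.IsRegular) (hτ : τ ≠ 0) :
    {z : L2 Ω × L2 Ω × L2V Ω × L2V Ω | SolvesMixed c τ Θ' z.1 z.2.1 z.2.2.1 z.2.2.2} =
      (fun z : L2 Ω × L2 Ω => (z.1, z.2, (hc.memLp_saturationFlux z.1 z.2).toLp,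
        (hc.memLp_totalFlux z.1 z.2).toLp)) '' {z | SolvesConformal c τ Θ' z.1 z.2} := by
  ext ⟨Θ, p, q, u⟩
  simp only [mem_ofPred_eq, hc.solvesMixed_iff hΩ hτ, mem_image, Prod.exists, Prod.mk.injEq]
  constructor
  · rintro ⟨h, hq, hu⟩
    exact ⟨Θ, p, h, rfl, rfl, ((eq_toLp_iff_ae_eq _).2 hq).symm, ((eq_toLp_iff_ae_eq _).2 hu).symm⟩
  · rintro ⟨_, _, h, rfl, rfl, rfl, rfl⟩
    exact ⟨h, MemLp.coeFn_toLp _, MemLp.coeFn_toLp _⟩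

theorem subsingleton_setOf_solvesMixed_iff (hΩ : IsOpen Ω) (hc : c.IsRegular) (hτ : τ ≠ 0) :
    {z : L2 Ω × L2 Ω × L2V Ω × L2V Ω |
      SolvesMixed c τ Θ' z.1 z.2.1 z.2.2.1 z.2.2.2}.Subsingleton ↔
      {z : L2 Ω × L2 Ω | SolvesConformal c τ Θ' z.1 z.2}.Subsingleton := by
  rw [hc.setOf_solvesMixed_eq_image hΩ hτ]
  refine Function.Injective.subsingleton_image_iff fun z z' h => ?_
  obtain ⟨hΘ, h⟩ := Prod.mk.inj h
  exact Prod.ext hΘ (Prod.mk.inj h).1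

end Coeffs.IsRegular

end TwoPhase

end

theorem mainTheorem4_general (d : ℕ) (Ω : Set (E d)) (hΩ : IsOpen Ω) (hfin : volume Ω ≠ ⊤)
    (c : Coeffs d) (hc : c.IsRegular) (τ : ℝ) (hτ : τ ≠ 0) (Θ' : L2 Ω) :
    (∀ Θ p : L2 Ω, SolvesConformal c τ Θ' Θ p →
      ∃ q u : L2V Ω,
        (∀ᵐ x ∂(volume.restrict Ω), q x =
          -weakGrad Θ x
            - (c.fw (c.s (Θ x)) / c.a (c.s (Θ x))) • (weakGrad p x + c.f₃ (c.s (Θ x)))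
            + c.f₁ (c.s (Θ x))) ∧
        (∀ᵐ x ∂(volume.restrict Ω), u x =
          -((1 / c.a (c.s (Θ x))) • (weakGrad p x + c.f₃ (c.s (Θ x))))) ∧
        SolvesMixed c τ Θ' Θ p q u) ∧
    (∀ (Θ p : L2 Ω) (q u : L2V Ω), SolvesMixed c τ Θ' Θ p q u →
      MemH10 Θ ∧ MemH10 p ∧ SolvesConformal c τ Θ' Θ p) ∧
    ((∃ Θ p : L2 Ω, SolvesConformal c τ Θ' Θ p) ↔
      ∃ (Θ p : L2 Ω) (q u : L2V Ω), SolvesMixed c τ Θ' Θ p q u) ∧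
    ({z : L2 Ω × L2 Ω | SolvesConformal c τ Θ' z.1 z.2}.Subsingleton ↔
      {z : L2 Ω × L2 Ω × L2V Ω × L2V Ω |
        SolvesMixed c τ Θ' z.1 z.2.1 z.2.2.1 z.2.2.2}.Subsingleton) := by
  have : IsFiniteMeasure (volume.restrict Ω) := isFiniteMeasure_restrict.2 hfin
  have mixed_of_conformal {Θ p : L2 Ω} (h : SolvesConformal c τ Θ' Θ p) :
      SolvesMixed c τ Θ' Θ p (hc.memLp_saturationFlux Θ p).toLp (hc.memLp_totalFlux Θ p).toLp :=
    (hc.solvesMixed_iff hΩ hτ).2 ⟨h, MemLp.coeFn_toLp _, MemLp.coeFn_toLp _⟩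
  have conformal_of_mixed {Θ p : L2 Ω} {q u : L2V Ω} (h : SolvesMixed c τ Θ' Θ p q u) :
      SolvesConformal c τ Θ' Θ p := ((hc.solvesMixed_iff hΩ hτ).1 h).1
  refine ⟨fun Θ p h => ⟨_, _, MemLp.coeFn_toLp _, MemLp.coeFn_toLp _, mixed_of_conformal h⟩,
    fun Θ p q u h => ?_, ⟨?_, ?_⟩, (hc.subsingleton_setOf_solvesMixed_iff hΩ hτ).symm⟩
  · have h' := conformal_of_mixed h
    exact ⟨h'.Θ_mem, h'.p_mem, h'⟩
  · exact fun ⟨Θ, p, h⟩ => ⟨Θ, p, _, _, mixed_of_conformal h⟩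
  · exact fun ⟨Θ, p, _, _, h⟩ => ⟨Θ, p, conformal_of_mixed h⟩

theorem mainTheorem4 (d : ℕ) (Ω : Set (E d)) (hΩ : IsOpen Ω) (hb : Bornology.IsBounded Ω)
    (c : Coeffs d) (hc : c.Admissible) (τ : ℝ) (hτ : 0 < τ) (Θ' : L2 Ω) :
    -- conformal solutions give mixed solutions, with explicit fluxes
    (∀ Θ p : L2 Ω, SolvesConformal c τ Θ' Θ p →
      ∃ q u : L2V Ω,
        (∀ᵐ x ∂(volume.restrict Ω), q x =
          -weakGrad Θ x
            - (c.fw (c.s (Θ x)) / c.a (c.s (Θ x))) • (weakGrad p x + c.f₃ (c.s (Θ x)))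
            + c.f₁ (c.s (Θ x))) ∧
        (∀ᵐ x ∂(volume.restrict Ω), u x =
          -((1 / c.a (c.s (Θ x))) • (weakGrad p x + c.f₃ (c.s (Θ x))))) ∧
        SolvesMixed c τ Θ' Θ p q u) ∧
    -- mixed solutions lie in `H¹₀` and are conformal solutions
    (∀ (Θ p : L2 Ω) (q u : L2V Ω), SolvesMixed c τ Θ' Θ p q u →
      MemH10 Θ ∧ MemH10 p ∧ SolvesConformal c τ Θ' Θ p) ∧
    -- hence existence and uniqueness carry over
    ((∃ Θ p : L2 Ω, SolvesConformal c τ Θ' Θ p) ↔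
      ∃ (Θ p : L2 Ω) (q u : L2V Ω), SolvesMixed c τ Θ' Θ p q u) ∧
    ({z : L2 Ω × L2 Ω | SolvesConformal c τ Θ' z.1 z.2}.Subsingleton ↔
      {z : L2 Ω × L2 Ω × L2V Ω × L2V Ω |
        SolvesMixed c τ Θ' z.1 z.2.1 z.2.2.1 z.2.2.2}.Subsingleton) := by
  exact mainTheorem4_general d Ω hΩ hb.measure_lt_top.ne c hc.isRegular τ hτ.ne' Θ'
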